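/- Throughout, topologies on a fixed group are counted as distinct if they are distinct as families of open sets. A group topology $\tau$ on an Abelian group $G$ is an \emph{SC-group topology} if it is Hausdorff, precompact (for every nonempty open $U\subseteq G$ there is a finite $F\subseteq G$ with $G=F+U$), and every subgroup of $G$ is $\tau$-closed. Let $r_0(G)$ denote the torsion-free rank of $G$ (the cardinality of a maximal independent system of elements of infinite order), and let $\mathfrak c=2^{\aleph_0}$. \textbf{Theorem.} Let $G$ be an Abelian group. (1) If $r_0(G)>0$, then $G$ admits at least $2^{\mathfrak c}\cdot 2^{2^{r_0(G)}}$ SC-group topologies. (2) If $G$ is infinite and $r_0(G)=|G|$, then $G$ admits exactly $2^{2^{|G|}}$ SC-group topologies. -/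

import Mathlib

/-- A topology on an (additively written) group is precompact if finitely many translates of
each nonempty open set cover the group. -/
def IsPrecompactTopology {G : Type*} [AddCommGroup G] (τ : TopologicalSpace G) : Prop :=
  ∀ U : Set G, @IsOpen G τ U → U.Nonempty →
    ∃ F : Set G, F.Finite ∧ ∀ g : G, ∃ f ∈ F, ∃ u ∈ U, g = f + u

/-- An SC-group topology on an Abelian group: a totally bounded (that is, precompact and
Hausdorff) group topology for which every subgroup is closed. -/
structure IsSCGroupTopology {G : Type*} [AddCommGroup G] (τ : TopologicalSpace G) : Prop where
  isTopologicalAddGroup : @IsTopologicalAddGroup G τ _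
  t2Space : @T2Space G τ
  precompact : IsPrecompactTopology τ
  isClosed_addSubgroup : ∀ H : AddSubgroup G, @IsClosed G τ (H : Set G)

/-- The torsion-free rank of an Abelian group: the (largest) cardinality of a family of elements
that is linearly independent over the integers, i.e. of an independent system of elements of
infinite order. -/
noncomputable def torsionFreeRank (G : Type*) [AddCommGroup G] : Cardinal :=
  Module.rank ℤ G

/-! Characters of finite order at every point separate points from subgroups, since ℚ/ℤ is an
injective cogenerator. So any set of characters containing all of them induces an SC-group topology,
precompact because powers of the circle are compact. Adjoin subsets of a family `χ` indexed by `K`: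
if no `χ b` is continuous for the topology given by the others, distinct subsets give distinct
topologies, hence `2 ^ #K` of them. Such families come from prescribing values on independent
elements `e i`. Multiples by `2 ^ n * n!` eventually kill any finite set of torsion-valued
characters, while lacunary sums let each character be small or large there at will. Independent-type
set families then give `K` of size `𝔠` (on `ℕ`, using one `e i`) or `2 ^ #I` (on an infinite `I`).
The upper bound counts families of subsets. -/

open Cardinal

/-- The coarsest topology for which all characters in `X` are continuous. -/
abbrev characterTopology {G : Type*} [AddCommGroup G] (X : Set (G →+ UnitAddCircle)) :
    TopologicalSpace G :=
  ⨅ χ : X, TopologicalSpace.induced χ.1 inferInstance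

universe u

/-! ### Topologies induced by characters -/

section CharacterTopology

variable {G : Type*} [AddCommGroup G] {X : Set (G →+ UnitAddCircle)}

theorem isTopologicalAddGroup_characterTopology :
    @IsTopologicalAddGroup G (characterTopology X) _ :=
  topologicalAddGroup_iInf fun χ => topologicalAddGroup_induced χ.1

theorem continuous_characterTopology {χ : G →+ UnitAddCircle} (hχ : χ ∈ X) :
    @Continuous _ _ (characterTopology X) _ χ :=
  continuous_iff_le_induced.2 (iInf_le _ (⟨χ, hχ⟩ : X))

theorem exists_finset_of_mem_nhds_characterTopology {g : G} {U : Set G}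
    (hU : U ∈ @nhds G (characterTopology X) g) :
    ∃ T : Finset (G →+ UnitAddCircle), ↑T ⊆ X ∧ ∃ ε > 0,
      ∀ h, (∀ χ ∈ T, ‖χ (h - g)‖ < ε) → h ∈ U := by
  classical
  rw [characterTopology, nhds_iInf] at hU
  refine Filter.iInf_sets_induct hU ⟨∅, by simp, 1, one_pos, by simp⟩ ?_
  · rintro χ s t hs ⟨T, hTX, ε, hε, hT⟩
    rw [nhds_induced] at hs
    obtain ⟨V, hV, hVs⟩ := hs
    obtain ⟨δ, hδ, hδV⟩ := Metric.mem_nhds_iff.1 hV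
    refine ⟨insert χ.1 T, ?_, min ε δ, lt_min hε hδ, fun h hh => ⟨hVs (hδV ?_), hT h ?_⟩⟩
    · simp [Set.insert_subset_iff, hTX]
    · have := hh χ.1 (Finset.mem_insert_self _ _)
      rw [map_sub] at this
      rw [Metric.mem_ball, dist_eq_norm]
      exact this.trans_le (min_le_right _ _)
    · exact fun ψ hψ => (hh ψ (Finset.mem_insert_of_mem hψ)).trans_le (min_le_left _ _)

theorem isPrecompactTopology_characterTopology : IsPrecompactTopology (characterTopology X) := by
  rintro U hU ⟨u, hu⟩
  obtain ⟨T, -, ε, hε, hT⟩ := exists_finset_of_mem_nhds_characterTopology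
    ((@IsOpen.mem_nhds_iff G (characterTopology X) u U hU).2 hu)
  let Φ : G → (T → UnitAddCircle) := fun g χ => χ.1 g
  have htb : TotallyBounded (Set.range Φ) := isCompact_univ.totallyBounded.subset (Set.subset_univ _)
  obtain ⟨t, hts, htf, hcov⟩ := Metric.finite_approx_of_totallyBounded htb ε hε
  have hsec : ∀ y ∈ t, ∃ g, Φ g = y := fun y hy => hts hy
  choose! p hp using hsec
  refine ⟨(fun y => p y - u) '' t, htf.image _, fun g => ?_⟩
  have hg := hcov ⟨g, rfl⟩
  simp only [Set.mem_iUnion, exists_prop] at hg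
  obtain ⟨y, hy, hgy⟩ := hg
  rw [← hp y hy] at hgy
  refine ⟨p y - u, ⟨y, hy, rfl⟩, g - p y + u, hT _ fun χ hχ => ?_, by abel⟩
  rw [add_sub_cancel_right, map_sub, ← dist_eq_norm]
  exact (dist_le_pi_dist (Φ g) (Φ (p y)) ⟨χ, hχ⟩).trans_lt hgy

theorem isSCGroupTopology_characterTopology
    (hX : ∀ (H : AddSubgroup G), ∀ g ∉ H, ∃ χ ∈ X, (∀ h ∈ H, χ h = 0) ∧ χ g ≠ 0) :
    IsSCGroupTopology (characterTopology X) := by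
  have hclosed : ∀ H : AddSubgroup G, @IsClosed G (characterTopology X) (H : Set G) := by
    intro H
    let _ := characterTopology X
    have : (H : Set G) = ⋂ χ ∈ {χ | χ ∈ X ∧ ∀ h ∈ H, χ h = 0}, χ ⁻¹' {0} := by
      ext g
      simp only [SetLike.mem_coe, Set.mem_iInter, Set.mem_ofPred_eq, Set.mem_preimage,
        Set.mem_singleton_iff]
      refine ⟨fun hg χ hχ => hχ.2 g hg, fun h => ?_⟩
      by_contra hg
      obtain ⟨χ, hχX, hχH, hχg⟩ := hX H g hg
      exact hχg (h χ ⟨hχX, hχH⟩)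
    rw [this]
    exact isClosed_biInter fun χ hχ =>
      isClosed_singleton.preimage (continuous_characterTopology hχ.1)
  refine ⟨isTopologicalAddGroup_characterTopology, ?_, isPrecompactTopology_characterTopology,
    hclosed⟩
  let _ := characterTopology X
  have : IsTopologicalAddGroup G := isTopologicalAddGroup_characterTopology
  have h0 : IsClosed ({0} : Set G) := by simpa using hclosed ⊥
  have : T1Space G := IsTopologicalAddGroup.t1Space G h0
  infer_instance

/-- Pull back a ℚ/ℤ-valued character of `G ⧸ H` not vanishing at `g`, then embed ℚ/ℤ in ℝ/ℤ. -/
theorem exists_torsion_character {H : AddSubgroup G} {g : G} (hg : g ∉ H) :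
    ∃ χ : G →+ UnitAddCircle, (∀ x, IsOfFinAddOrder (χ x)) ∧ (∀ h ∈ H, χ h = 0) ∧ χ g ≠ 0 := by
  have hg' : (QuotientAddGroup.mk g : G ⧸ H) ≠ 0 := by
    rwa [Ne, QuotientAddGroup.eq_zero_iff]
  obtain ⟨c, hc⟩ := CharacterModule.exists_character_apply_ne_zero_of_ne_zero hg'
  let ι : AddCircle (1 : ℚ) →+ UnitAddCircle :=
    QuotientAddGroup.map _ (AddSubgroup.zmultiples (1 : ℝ)) (Rat.castHom ℝ).toAddMonoidHom (by
      rintro _ ⟨n, rfl⟩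
      exact ⟨n, by simp⟩)
  have hι : ∀ q : ℚ, ι (q : AddCircle (1 : ℚ)) = ((q : ℝ) : UnitAddCircle) := fun q => rfl
  have hιinj : ∀ x, ι x = 0 → x = 0 := by
    intro x
    induction x using QuotientAddGroup.induction_on with
    | H q =>
      intro h
      replace h := (hι q).symm.trans h
      rw [AddCircle.coe_eq_zero_iff] at h
      obtain ⟨n, hn⟩ := h
      refine (AddCircle.coe_eq_zero_iff (1 : ℚ)).2 ⟨n, ?_⟩
      have : ((n • (1 : ℚ) : ℚ) : ℝ) = q := by simpa using hn
      exact_mod_cast this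
  refine ⟨(ι.comp (c : (G ⧸ H) →+ AddCircle (1 : ℚ))).comp (QuotientAddGroup.mk' H), fun x => ?_,
    fun h hh => ?_, fun h => hc (hιinj _ h)⟩
  · refine ι.isOfFinAddOrder ?_
    generalize ((c : (G ⧸ H) →+ AddCircle (1 : ℚ)) (QuotientAddGroup.mk' H x)) = y
    induction y using QuotientAddGroup.induction_on with
    | H q =>
      refine isOfFinAddOrder_iff_nsmul_eq_zero.2 ⟨q.den, q.den_pos, ?_⟩
      change ((q.den • q : ℚ) : AddCircle (1 : ℚ)) = 0
      refine (AddCircle.coe_eq_zero_iff (1 : ℚ)).2 ⟨q.num, ?_⟩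
      rw [nsmul_eq_mul, Rat.den_mul_eq_num]
      simp
  · have : (QuotientAddGroup.mk' H h) = 0 := (QuotientAddGroup.eq_zero_iff h).2 hh
    rw [AddMonoidHom.comp_apply, this, map_zero]

end CharacterTopology

/-! ### From independent characters to many topologies -/

section Counting

variable {G : Type u} [AddCommGroup G]

/-- The torsion-valued characters together with the members of the family `χ` indexed by `S`. -/
def torsionCharactersUnion {K : Type*} (χ : K → G →+ UnitAddCircle) (S : Set K) :
    Set (G →+ UnitAddCircle) :=
  {ψ | ∀ x, IsOfFinAddOrder (ψ x)} ∪ χ '' S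

/-- `hχ` puts points with `‖χ b g‖ ≥ δ` in every basic neighbourhood of 0 not involving `b`, so the
topology of `S` determines `S`. -/
theorem two_power_le_mk_isSCGroupTopology {K : Type u} (χ : K → G →+ UnitAddCircle) {δ : ℝ}
    (hδ : 0 < δ)
    (hχ : ∀ (T : Finset K) (Y : Finset (G →+ UnitAddCircle)),
      (∀ ψ ∈ Y, ∀ x, IsOfFinAddOrder (ψ x)) → ∀ b ∉ T, ∀ ε > 0,
        ∃ g, (∀ ψ ∈ Y, ψ g = 0) ∧ (∀ s ∈ T, ‖χ s g‖ < ε) ∧ δ ≤ ‖χ b g‖) :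
    (2 : Cardinal) ^ #K ≤ #{τ : TopologicalSpace G // IsSCGroupTopology τ} := by
  classical
  have key : ∀ S S' : Set K, characterTopology (torsionCharactersUnion χ S) =
      characterTopology (torsionCharactersUnion χ S') → S' ⊆ S := by
    intro S S' h b hb
    by_contra hbS
    have hcont : @Continuous _ _ (characterTopology (torsionCharactersUnion χ S)) _ (χ b) := by
      rw [h]
      exact continuous_characterTopology (Or.inr ⟨b, hb, rfl⟩)
    have hU : (χ b) ⁻¹' Metric.ball 0 δ ∈
        @nhds G (characterTopology (torsionCharactersUnion χ S)) 0 :=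
      @ContinuousAt.preimage_mem_nhds _ _ (characterTopology (torsionCharactersUnion χ S)) _ _ _ _
        (@Continuous.continuousAt _ _ (characterTopology (torsionCharactersUnion χ S)) _ _ 0 hcont)
        (by rw [map_zero]; exact Metric.ball_mem_nhds _ hδ)
    obtain ⟨T, hTX, ε, hε, hT⟩ := exists_finset_of_mem_nhds_characterTopology hU
    let Y := T.filter fun ψ => ∀ x, IsOfFinAddOrder (ψ x)
    have hZ : ((T.filter fun ψ => ¬ ∀ x, IsOfFinAddOrder (ψ x) : Finset _) : Set _) ⊆ χ '' S := by
      intro ψ hψ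
      obtain ⟨h1, h2⟩ := Finset.mem_filter.1 hψ
      exact (hTX h1).resolve_left h2
    obtain ⟨Z, hZS, hZe⟩ := Finset.subset_set_image_iff.1 hZ
    obtain ⟨g, hgY, hgZ, hgb⟩ := hχ Z Y (fun ψ hψ => (Finset.mem_filter.1 hψ).2) b
      (fun hbZ => hbS (hZS hbZ)) ε hε
    have hg : g ∈ (χ b) ⁻¹' Metric.ball 0 δ := by
      refine hT g fun ψ hψ => ?_
      rw [sub_zero]
      by_cases hψt : ∀ x, IsOfFinAddOrder (ψ x)
      · rw [hgY ψ (Finset.mem_filter.2 ⟨hψ, hψt⟩), norm_zero]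
        exact hε
      · have : ψ ∈ Z.image χ := by rw [hZe]; exact Finset.mem_filter.2 ⟨hψ, hψt⟩
        obtain ⟨s, hs, rfl⟩ := Finset.mem_image.1 this
        exact hgZ s hs
    rw [Set.mem_preimage, mem_ball_zero_iff] at hg
    exact hg.not_ge hgb
  rw [← Cardinal.mk_set]
  refine Cardinal.mk_le_of_injective (f := fun S : Set K =>
    (⟨characterTopology (torsionCharactersUnion χ S),
      isSCGroupTopology_characterTopology fun H g hg => ?_⟩ :
      {τ : TopologicalSpace G // IsSCGroupTopology τ})) fun S S' h => ?_
  · obtain ⟨ψ, h1, h2⟩ := exists_torsion_character hg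
    exact ⟨ψ, Or.inl h1, h2⟩
  · have h' := congrArg Subtype.val h
    exact (key S' S h'.symm).antisymm (key S S' h')

end Counting

/-! ### A Hausdorff-style independent family -/

theorem exists_set_family_infinite_diff (I : Type*) [Infinite I] :
    ∃ A : Set I → Set I, ∀ (T : Finset (Set I)), ∀ b ∉ T,
      {i | i ∈ A b ∧ ∀ s ∈ T, i ∉ A s}.Infinite := by
  classical
  have hcard : #I = #(Finset I × Finset (Finset I)) := by
    simp [Cardinal.mk_prod, Cardinal.mk_finset_of_infinite]
  obtain ⟨e⟩ := Cardinal.eq.1 hcard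
  -- An index codes a finite set `F` and finitely many finite sets; it lies in `A S` when `F ∩ S` is
  -- one of them.
  refine ⟨fun S => {i | (e i).1.filter (· ∈ S) ∈ (e i).2}, fun T b hb => ?_⟩
  have hsep : ∀ s : Set I, ∃ x, s ≠ b → ¬(x ∈ s ↔ x ∈ b) := by
    intro s
    by_cases h : s = b
    · exact ⟨Classical.arbitrary I, fun h' => absurd h h'⟩
    · by_contra! hc
      exact h (Set.ext fun x => (hc x).2)
  choose x hx using hsep
  let F₀ := T.image x
  have hinf : ((F₀ : Set I)ᶜ).Infinite := F₀.finite_toSet.infinite_compl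
  -- `F₀` already separates `b` from each `s ∈ T`; enlarging it by one point gives infinitely many
  -- codes.
  refine Set.infinite_of_injOn_mapsTo (f := fun i =>
    e.symm (insert i F₀, {(insert i F₀).filter (· ∈ b)})) ?_ ?_ hinf
  · intro i hi j hj hij
    have h : insert i F₀ = insert j F₀ := congrArg Prod.fst (e.symm.injective hij)
    have : i ∈ insert j F₀ := h ▸ Finset.mem_insert_self i F₀
    exact (Finset.mem_insert.1 this).resolve_right hi
  · intro i _
    refine ⟨by simp, fun s hs hmem => ?_⟩
    simp only [Set.mem_ofPred_eq, Equiv.apply_symm_apply, Finset.mem_singleton] at hmem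
    have hsb : s ≠ b := fun h => hb (h ▸ hs)
    have hxF : x s ∈ insert i F₀ := Finset.mem_insert_of_mem (Finset.mem_image_of_mem _ hs)
    have := congrArg (x s ∈ ·) hmem
    simp only [Finset.mem_filter, hxF, true_and, eq_iff_iff] at this
    exact hx s hsb this

/-! ### Lacunary series detecting membership -/

section FactorialSeries

open Classical in
/-- The terms of the series `∑ k ∈ A, 1 / (2 * (2 ^ k * k !))`. -/
noncomputable def factorialTerm (A : Set ℕ) (k : ℕ) : ℝ :=
  if k ∈ A then 1 / (2 * (2 ^ k * (k.factorial : ℝ))) else 0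

/-- The sum of the series `∑ k ∈ A, 1 / (2 * (2 ^ k * k !))`. -/
noncomputable def factorialSum (A : Set ℕ) : ℝ := ∑' k, factorialTerm A k

theorem factorialTerm_nonneg (A : Set ℕ) (k : ℕ) : 0 ≤ factorialTerm A k := by
  unfold factorialTerm
  split_ifs <;> positivity

theorem two_pow_mul_factorial_mul_factorialTerm_le (A : Set ℕ) (n j : ℕ) :
    2 ^ n * (n.factorial : ℝ) * factorialTerm A (j + (n + 1)) ≤
      1 / (2 * (n + 1)) * (1 / 2 / 2 ^ j) := by
  unfold factorialTerm
  split_ifs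
  · have h : (n.factorial : ℝ) * (n + 1) ≤ ((j + (n + 1)).factorial : ℝ) := by
      have : (n + 1).factorial ≤ (j + (n + 1)).factorial := Nat.factorial_le (by omega)
      rw [Nat.factorial_succ, mul_comm] at this
      exact_mod_cast this
    rw [mul_one_div, div_le_iff₀ (by positivity)]
    calc (2 : ℝ) ^ n * n.factorial
        = 1 / (2 * (n + 1)) * (1 / 2 / 2 ^ j) *
          (2 * (2 ^ (j + (n + 1)) * (n.factorial * (n + 1)))) := by
          rw [pow_add, pow_succ]; field_simp
      _ ≤ _ := by gcongr
  · rw [mul_zero]; positivity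

theorem summable_factorialTerm (A : Set ℕ) : Summable (factorialTerm A) := by
  rw [← summable_nat_add_iff (0 + 1)]
  refine Summable.of_nonneg_of_le (fun _ => factorialTerm_nonneg _ _) (fun j => ?_)
    ((summable_geometric_two' (1 : ℝ)).mul_left (1 / (2 * (((0 : ℕ) : ℝ) + 1))))
  simpa using two_pow_mul_factorial_mul_factorialTerm_le A 0 j

open Classical in
-- Multiplied by `2 ^ n * n!`, terms before `n` become integers, the `n`-th becomes 1/2 or 0, and
-- the tail is dominated by a geometric series.
theorem exists_two_pow_mul_factorial_mul_factorialSum (A : Set ℕ) (n : ℕ) :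
    ∃ (z : ℤ) (t : ℝ), 2 ^ n * (n.factorial : ℝ) * factorialSum A =
      z + (if n ∈ A then 1 / 2 else 0) + t ∧ |t| ≤ 1 / (2 * (n + 1)) := by
  set a : ℝ := 2 ^ n * (n.factorial : ℝ) with ha
  have hsplit := (summable_factorialTerm A).sum_add_tsum_nat_add (n + 1)
  have hint : ∃ z : ℤ, a * ∑ k ∈ Finset.range n, factorialTerm A k = z := by
    rw [Finset.mul_sum]
    have : ∀ k ∈ Finset.range n, ∃ z : ℤ, a * factorialTerm A k = z := by
      intro k hk
      have hkn := Finset.mem_range.1 hk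
      unfold factorialTerm
      split_ifs
      · obtain ⟨c, hc⟩ : 2 ^ (k + 1) * k.factorial ∣ 2 ^ n * n.factorial :=
          mul_dvd_mul (pow_dvd_pow 2 hkn) (Nat.factorial_dvd_factorial hkn.le)
        refine ⟨c, ?_⟩
        have : a = 2 ^ (k + 1) * k.factorial * c := by rw [ha]; exact_mod_cast hc
        rw [this, pow_succ]
        push_cast
        field_simp
      · exact ⟨0, by simp⟩
    choose! z hz using this
    exact ⟨∑ k ∈ Finset.range n, z k, by rw [Finset.sum_congr rfl hz]; push_cast; rfl⟩
  obtain ⟨z, hz⟩ := hint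
  refine ⟨z, a * ∑' j, factorialTerm A (j + (n + 1)), ?_, ?_⟩
  · have hmid : a * factorialTerm A n = if n ∈ A then 1 / 2 else 0 := by
      unfold factorialTerm
      split_ifs
      · rw [ha]; field_simp
      · simp
    rw [factorialSum, ← hsplit, Finset.sum_range_succ, mul_add, mul_add, hz, hmid]
  · rw [abs_of_nonneg (mul_nonneg (by positivity) (tsum_nonneg fun _ => factorialTerm_nonneg _ _)),
      ← tsum_mul_left]
    refine (((summable_nat_add_iff (n + 1)).2 (summable_factorialTerm A)).mul_left a).tsum_le_tsum
      (two_pow_mul_factorial_mul_factorialTerm_le A n)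
      ((summable_geometric_two' (1 : ℝ)).mul_left _) |>.trans_eq ?_
    rw [tsum_mul_left, tsum_geometric_two', mul_one]

theorem norm_coe_unitAddCircle_le (t : ℝ) : ‖(t : UnitAddCircle)‖ ≤ |t| := by
  rw [UnitAddCircle.norm_eq]
  simpa using round_le t 0

theorem norm_nsmul_factorialSum_le {A : Set ℕ} {n : ℕ} (hn : n ∉ A) :
    ‖(2 ^ n * n.factorial) • (factorialSum A : UnitAddCircle)‖ ≤ 1 / (2 * (n + 1)) := by
  obtain ⟨z, t, h, ht⟩ := exists_two_pow_mul_factorial_mul_factorialSum A n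
  rw [if_neg hn, add_zero] at h
  have : (2 ^ n * n.factorial) • (factorialSum A : UnitAddCircle) = (t : UnitAddCircle) := by
    rw [← AddCircle.coe_nsmul, nsmul_eq_mul]
    push_cast
    rw [h, AddCircle.coe_add, (AddCircle.coe_eq_zero_iff (1 : ℝ)).2 ⟨z, by simp⟩, zero_add]
  rw [this]
  exact (norm_coe_unitAddCircle_le t).trans ht

theorem le_norm_nsmul_factorialSum {A : Set ℕ} {n : ℕ} (hn : n ∈ A) (hn1 : 1 ≤ n) :
    1 / 4 ≤ ‖(2 ^ n * n.factorial) • (factorialSum A : UnitAddCircle)‖ := by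
  obtain ⟨z, t, h, ht⟩ := exists_two_pow_mul_factorial_mul_factorialSum A n
  rw [if_pos hn] at h
  have : (2 ^ n * n.factorial) • (factorialSum A : UnitAddCircle) =
      ((1 / 2 : ℝ) : UnitAddCircle) + (t : UnitAddCircle) := by
    rw [← AddCircle.coe_nsmul, nsmul_eq_mul]
    push_cast
    rw [h, AddCircle.coe_add, AddCircle.coe_add,
      (AddCircle.coe_eq_zero_iff (1 : ℝ)).2 ⟨z, by simp⟩, zero_add]
  rw [this]
  have hhalf : ‖((1 / 2 : ℝ) : UnitAddCircle)‖ = 1 / 2 := by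
    simpa using AddCircle.norm_half_period_eq (1 : ℝ)
  have h1 := norm_sub_le_norm_add ((1 / 2 : ℝ) : UnitAddCircle) (t : UnitAddCircle)
  have h2 := (norm_coe_unitAddCircle_le t).trans ht
  have h3 : 1 / (2 * ((n : ℝ) + 1)) ≤ 1 / 4 := by
    have : (1 : ℝ) ≤ n := by exact_mod_cast hn1
    exact one_div_le_one_div_of_le (by norm_num) (by linarith)
  linarith

end FactorialSeries

/-! ### Characters prescribed on independent elements -/

section Rank

variable {G : Type u} [AddCommGroup G]

/-- The circle is divisible, hence injective. -/
theorem exists_character_extension {I : Type*} {e : I → G} (he : LinearIndependent ℤ e)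
    (α : I → UnitAddCircle) : ∃ χ : G →+ UnitAddCircle, ∀ i, χ (e i) = α i := by
  obtain ⟨χ, hχ⟩ := (Module.Baer.of_divisible UnitAddCircle).extension_property
    (Finsupp.linearCombination ℤ e) he (Finsupp.linearCombination ℤ α)
  refine ⟨χ.toAddMonoidHom, fun i => ?_⟩
  simpa using LinearMap.congr_fun hχ (Finsupp.single i 1)

theorem two_power_le_mk_isSCGroupTopology_of_linearIndependent {I : Type*} {e : I → G}
    (he : LinearIndependent ℤ e) {K : Type u} (D : K → I → Set ℕ)
    (hD : ∀ (T : Finset K), ∀ b ∉ T, ∃ i, {n | n ∈ D b i ∧ ∀ s ∈ T, n ∉ D s i}.Infinite) :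
    (2 : Cardinal) ^ #K ≤ #{τ : TopologicalSpace G // IsSCGroupTopology τ} := by
  choose χ hχ using fun b =>
    exists_character_extension he fun i => (factorialSum (D b i) : UnitAddCircle)
  refine two_power_le_mk_isSCGroupTopology χ (δ := 1 / 4) (by norm_num)
    fun T Y hY b hb ε hε => ?_
  obtain ⟨i, hi⟩ := hD T b hb
  -- Once `n ≥ N`, `n!` is a multiple of all these orders, so `Y` vanishes at the witness.
  let N := ∏ ψ ∈ Y, addOrderOf (ψ (e i))
  obtain ⟨M, hM⟩ := exists_nat_one_div_lt hε
  obtain ⟨n, ⟨hnb, hnT⟩, hn⟩ := hi.exists_gt (N + M + 1)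
  refine ⟨(2 ^ n * n.factorial) • e i, fun ψ hψ => ?_, fun s hs => ?_, ?_⟩
  · have hpos : 0 < N := Finset.prod_pos fun ψ hψ => (hY ψ hψ _).addOrderOf_pos
    rw [map_nsmul]
    exact addOrderOf_dvd_iff_nsmul_eq_zero.1 ((Finset.dvd_prod_of_mem _ hψ).trans
      ((Nat.dvd_factorial hpos (by omega)).trans (dvd_mul_left _ _)))
  · rw [map_nsmul, hχ]
    refine (norm_nsmul_factorialSum_le (hnT s hs)).trans_lt (lt_of_le_of_lt ?_ hM)
    have : (M : ℝ) ≤ n := by exact_mod_cast (by omega : M ≤ n)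
    exact one_div_le_one_div_of_le (by positivity) (by linarith)
  · rw [map_nsmul, hχ]
    exact le_norm_nsmul_factorialSum hnb (by omega)

theorem two_power_two_power_le_mk_isSCGroupTopology {I : Type u} [Infinite I] {e : I → G}
    (he : LinearIndependent ℤ e) :
    (2 : Cardinal) ^ (2 : Cardinal) ^ #I ≤ #{τ : TopologicalSpace G // IsSCGroupTopology τ} := by
  classical
  obtain ⟨A, hA⟩ := exists_set_family_infinite_diff I
  rw [← Cardinal.mk_set]
  refine two_power_le_mk_isSCGroupTopology_of_linearIndependent he
    -- The choice at `e i` is all or nothing: the variety comes from `I`.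
    (fun S i => if i ∈ A S then Set.univ else ∅) fun T b hb => ?_
  obtain ⟨i, hib, hiT⟩ := (hA T b hb).nonempty
  refine ⟨i, Set.infinite_univ.mono fun n _ => ⟨by simp [hib], fun s hs => by simp [hiT s hs]⟩⟩

theorem two_power_continuum_le_mk_isSCGroupTopology {I : Type*} [Nonempty I] {e : I → G}
    (he : LinearIndependent ℤ e) :
    (2 : Cardinal.{u}) ^ 𝔠 ≤ #{τ : TopologicalSpace G // IsSCGroupTopology τ} := by
  obtain ⟨A, hA⟩ := exists_set_family_infinite_diff ℕ
  have hK : #(ULift.{u} (Set ℕ)) = 𝔠 := by simp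
  rw [← hK]
  refine two_power_le_mk_isSCGroupTopology_of_linearIndependent he (fun S _ => A S.down)
    fun T b hb => ⟨Classical.arbitrary I, (hA (T.map ⟨ULift.down, ULift.down_injective⟩) b.down
      ?_).mono fun n hn => ⟨hn.1, fun s hs => hn.2 _ ?_⟩⟩
  · simpa using hb
  · simpa using hs

end Rank

/-! ### Assembling the bounds -/

theorem mainTheorem10 {G : Type*} [AddCommGroup G] :
    (0 < torsionFreeRank G →
      2 ^ Cardinal.continuum * 2 ^ ((2 : Cardinal) ^ torsionFreeRank G) ≤
        Cardinal.mk {τ : TopologicalSpace G // IsSCGroupTopology τ}) ∧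
    (Infinite G → torsionFreeRank G = Cardinal.mk G →
      Cardinal.mk {τ : TopologicalSpace G // IsSCGroupTopology τ} =
        2 ^ ((2 : Cardinal) ^ Cardinal.mk G)) := by
  have hlower : 0 < torsionFreeRank G →
      2 ^ Cardinal.continuum * 2 ^ ((2 : Cardinal) ^ torsionFreeRank G) ≤
        Cardinal.mk {τ : TopologicalSpace G // IsSCGroupTopology τ} := by
    intro hpos
    obtain ⟨s, hs, hli⟩ := exists_set_linearIndependent ℤ G
    change #s = torsionFreeRank G at hs
    rw [← hs] at hpos ⊢
    have : Nonempty s := Cardinal.mk_ne_zero_iff.1 hpos.ne'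
    have hc := two_power_continuum_le_mk_isSCGroupTopology hli
    have hinf : ℵ₀ ≤ (2 : Cardinal) ^ 𝔠 := Cardinal.aleph0_le_continuum.trans (cantor _).le
    refine (mul_le_max_of_aleph0_le_left hinf).trans (max_le hc ?_)
    rcases finite_or_infinite s with hfin | hfin
    -- For finite rank the second factor is absorbed by `2 ^ 𝔠`.
    · refine le_trans (power_le_power_left two_ne_zero ?_) hc
      exact ((power_lt_aleph0 (natCast_lt_aleph0 (n := 2)) (lt_aleph0_of_finite s)).le).trans
        aleph0_le_continuum
    · exact two_power_two_power_le_mk_isSCGroupTopology hli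
  refine ⟨hlower, fun hG hr => le_antisymm ?_ ?_⟩
  · rw [← Cardinal.mk_set, ← Cardinal.mk_set]
    exact Cardinal.mk_le_of_injective (f := fun τ => {U : Set G | @IsOpen G τ.1 U})
      fun τ τ' h => Subtype.ext (TopologicalSpace.ext h)
  · have hpos : 0 < torsionFreeRank G := by
      rw [hr]
      exact aleph0_pos.trans_le (aleph0_le_mk G)
    rw [← hr]
    refine le_trans (le_mul_of_one_le_left' ?_) (hlower hpos)
    exact Cardinal.one_le_iff_pos.2 (power_pos _ two_pos)
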